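/- Let $P \subset \mathbb{R}^d$ be a $3$-dimensional lattice parallelepiped, i.e. the image of the cube $[0,1]^3$ under an injective affine map $\mathbb{R}^3 \to \mathbb{R}^d$, all of whose vertices lie in $\mathbb{Z}^d$ (the main case is $d = 3$). Then $P$ has a unimodular cover: there is a finite collection of unimodular lattice tetrahedra whose union equals $P$. Here a lattice tetrahedron $\operatorname{conv}(p_0,p_1,p_2,p_3)$, with $p_0,\dots,p_3 \in \mathbb{Z}^d$ affinely independent, is called unimodular if every point of $\mathbb{Z}^d$ in the affine span of $p_0,\dots,p_3$ is an affine combination of $p_0,\dots,p_3$ with integer coefficients; for $d = 3$ this means that $|\det(p_1-p_0,\,p_2-p_0,\,p_3-p_0)| = 1$. -/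

import Mathlib

/-- The integer lattice `ℤ^d`, as a set of points of `ℝ^d`. -/
def latticePoints (d : ℕ) : Set (Fin d → ℝ) :=
  {x | ∀ i, ∃ n : ℤ, x i = n}

/-- A `k`-dimensional parallelepiped in `ℝ^d`: the image of the unit cube `[0,1]^k` under an
injective affine map (so it is nondegenerate). -/
def IsParallelepiped {d : ℕ} (k : ℕ) (P : Set (Fin d → ℝ)) : Prop :=
  ∃ f : (Fin k → ℝ) →ᵃ[ℝ] (Fin d → ℝ), Function.Injective f ∧ P = f '' Set.Icc 0 1

/-- A `k`-dimensional lattice parallelepiped in `ℝ^d`: a parallelepiped all of whose vertices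
(extreme points) are lattice points. -/
def IsLatticeParallelepiped {d : ℕ} (k : ℕ) (P : Set (Fin d → ℝ)) : Prop :=
  IsParallelepiped k P ∧ Set.extremePoints ℝ P ⊆ latticePoints d

/-- A unimodular `k`-simplex in `ℝ^d`: the convex hull of `k + 1` affinely independent lattice
points that form an affine lattice basis of the lattice `ℤ^d ∩ aff`, where `aff` is their affine
span: every lattice point of `aff` is an integral affine combination of them.
(For `k = d` this says that the simplex has normalized volume one.) -/
def IsUnimodularSimplex {d : ℕ} (k : ℕ) (S : Set (Fin d → ℝ)) : Prop :=
  ∃ p : Fin (k + 1) → (Fin d → ℝ),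
    AffineIndependent ℝ p ∧
    (∀ i, p i ∈ latticePoints d) ∧
    (∀ x ∈ latticePoints d, x ∈ affineSpan ℝ (Set.range p) →
      ∃ m : Fin (k + 1) → ℤ, ∑ i, m i = 1 ∧ x = ∑ i, (m i : ℝ) • p i) ∧
    S = convexHull ℝ (Set.range p)

/-- A `k`-dimensional set `P` has a unimodular cover: there is a finite collection of unimodular
`k`-simplices whose union equals `P`. -/
def HasUnimodularCover {d : ℕ} (k : ℕ) (P : Set (Fin d → ℝ)) : Prop :=
  ∃ C : Set (Set (Fin d → ℝ)),
    C.Finite ∧ (∀ S ∈ C, IsUnimodularSimplex k S) ∧ ⋃₀ C = P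

/-! Pull back along `f`: `P` becomes the unit cube and `ℤ^d` a discrete group `L` containing `ℤ³`.
Among the nondegenerate tetrahedra in the cube with vertices in `L` that contain a point `x`, take
one of least volume. Its vertices generate `L`, and since only finitely many tetrahedra arise, they
form the cover.

Suppose they do not generate. By minimality, no point of `L` in the cube has all barycentric
coordinates below one (`exists_one_le`). So the tetrahedron is empty, and every nonintegral
coordinate vector has fractional parts that are positive with sum 2 (`fract_pos_and_sum_fract`).
Coordinate vectors modulo `ℤ⁴` are then determined by any single coordinate, hence form a cyclic
group, of order `N` say, and any prescribed coordinate takes the value `1/N`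
(`exists_minimal_coordinate`). The parallelepiped circumscribed about the tetrahedron has the four
further corners `(∑ v i)/2 - v k`, one of which lies in the cube (`exists_corner_mem_cube`). A point
of `L` just beyond the facet opposite that `v k` then lies in the cube with all coordinates below
one, a contradiction. -/

/-- The matrix whose rows are the homogeneous coordinates of four points of `ℝ³`. -/
def vertexMatrix (v : Fin 4 → Fin 3 → ℝ) : Matrix (Fin 4) (Fin 4) ℝ :=
  Matrix.of fun i => Fin.cons 1 (v i)

theorem vecMul_vertexMatrix_zero (v : Fin 4 → Fin 3 → ℝ) (β : Fin 4 → ℝ) :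
    Matrix.vecMul β (vertexMatrix v) 0 = ∑ i, β i := by
  simp [Matrix.vecMul, dotProduct, vertexMatrix]

theorem vecMul_vertexMatrix_succ (v : Fin 4 → Fin 3 → ℝ) (β : Fin 4 → ℝ) (a : Fin 3) :
    Matrix.vecMul β (vertexMatrix v) a.succ = (∑ i, β i • v i) a := by
  simp [Matrix.vecMul, dotProduct, vertexMatrix]

/-- Replacing a vertex by a point with barycentric coordinates `β` scales the determinant. -/
theorem det_vertexMatrix_update (v : Fin 4 → Fin 3 → ℝ) (β : Fin 4 → ℝ) (hβ : ∑ i, β i = 1)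
    (j : Fin 4) :
    (vertexMatrix (Function.update v j (∑ i, β i • v i))).det = β j * (vertexMatrix v).det := by
  rw [← smul_eq_mul, ← Matrix.det_updateRow_sum]
  congr 1
  ext i b
  rcases eq_or_ne i j with rfl | hij
  · refine Fin.cases ?_ (fun a => ?_) b
    · simp [vertexMatrix, hβ]
    · simp [vertexMatrix]
  · simp [vertexMatrix, hij]

theorem eq_zero_of_sum_smul_eq_zero {v : Fin 4 → Fin 3 → ℝ} (hv : (vertexMatrix v).det ≠ 0)
    {β : Fin 4 → ℝ} (h0 : ∑ i, β i = 0) (h1 : ∑ i, β i • v i = 0) : β = 0 := by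
  apply Matrix.eq_zero_of_vecMul_eq_zero hv
  ext b
  refine Fin.cases ?_ (fun a => ?_) b
  · rw [vecMul_vertexMatrix_zero, h0]; rfl
  · rw [vecMul_vertexMatrix_succ, h1]; rfl

theorem det_vertexMatrix_ne_zero {v : Fin 4 → Fin 3 → ℝ}
    (h : ∀ β : Fin 4 → ℝ, ∑ i, β i = 0 → ∑ i, β i • v i = 0 → β = 0) :
    (vertexMatrix v).det ≠ 0 := by
  intro h0
  obtain ⟨β, hβ, hβ'⟩ := Matrix.exists_vecMul_eq_zero_iff.2 h0
  refine hβ (h β ?_ ?_)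
  · rw [← vecMul_vertexMatrix_zero v, hβ']; rfl
  · ext a
    rw [← vecMul_vertexMatrix_succ, hβ']; rfl

/-! ### Volume-minimal tetrahedra -/

/-- `v` spans a nondegenerate tetrahedron in the unit cube with vertices in `L` containing `x`. -/
structure IsLatticeTetrahedronAt (L : AddSubgroup (Fin 3 → ℝ)) (x : Fin 3 → ℝ)
    (v : Fin 4 → Fin 3 → ℝ) : Prop where
  mem_lattice : ∀ i, v i ∈ L
  mem_cube : ∀ i, v i ∈ Set.Icc (0 : Fin 3 → ℝ) 1
  det_ne_zero : (vertexMatrix v).det ≠ 0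
  exists_weights : ∃ w : Fin 4 → ℝ, (∀ i, 0 ≤ w i) ∧ ∑ i, w i = 1 ∧ ∑ i, w i • v i = x

/-- In a tetrahedron of minimal volume among those containing `x`, no lattice point of the cube
has all barycentric coordinates smaller than one. -/
theorem IsLatticeTetrahedronAt.exists_one_le {L : AddSubgroup (Fin 3 → ℝ)} {x : Fin 3 → ℝ}
    {v : Fin 4 → Fin 3 → ℝ} (hv : IsLatticeTetrahedronAt L x v)
    (hmin : ∀ v', IsLatticeTetrahedronAt L x v' →
      |(vertexMatrix v).det| ≤ |(vertexMatrix v').det|)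
    {β : Fin 4 → ℝ} (hβ : ∑ i, β i = 1) (hL : ∑ i, β i • v i ∈ L)
    (hC : ∑ i, β i • v i ∈ Set.Icc (0 : Fin 3 → ℝ) 1) : ∃ j, 1 ≤ β j := by
  obtain ⟨w, hw0, hw1, hwx⟩ := hv.exists_weights
  have hne : (Finset.univ.filter fun i => 0 < β i).Nonempty := by
    by_contra h
    rw [Finset.not_nonempty_iff_eq_empty, Finset.filter_eq_empty_iff] at h
    have : ∑ i, β i ≤ 0 := Finset.sum_nonpos fun i hi => not_lt.1 (h hi)
    linarith
  -- Ratio test, as in the simplex method: with the least `w i / β i`, exchanging vertex `j` keeps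
  -- the weights of `x` nonnegative.
  obtain ⟨j, hj, hjmin⟩ := Finset.exists_min_image _ (fun i => w i / β i) hne
  have hj : 0 < β j := by simpa using hj
  set t := w j / β j with ht
  have ht0 : 0 ≤ t := div_nonneg (hw0 j) hj.le
  have htj : t * β j = w j := div_mul_cancel₀ _ hj.ne'
  have hle : ∀ i, 0 ≤ w i - t * β i := by
    intro i
    rcases le_or_gt (β i) 0 with hi | hi
    · nlinarith [hw0 i, mul_nonneg ht0 (neg_nonneg.2 hi)]
    · have := (le_div_iff₀ hi).1 (hjmin i (by simpa using hi))
      linarith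
  refine ⟨j, ?_⟩
  set v' := Function.update v j (∑ i, β i • v i) with hv'
  set w' : Fin 4 → ℝ := Function.update (fun i => w i - t * β i) j t with hw'
  -- General `M`, because it serves twice: `u = 1` gives the sum of the weights, `u = v` the point
  -- `x`.
  have key : ∀ {M : Type} [AddCommGroup M] [Module ℝ M] (u : Fin 4 → M),
      ∑ i, w' i • Function.update u j (∑ i, β i • u i) i = ∑ i, w i • u i := by
    intro M _ _ u
    have h1 : ∀ i, w' i • Function.update u j (∑ i, β i • u i) i =
        (w i - t * β i) • u i + if i = j then t • (∑ i, β i • u i) else 0 := by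
      intro i
      rcases eq_or_ne i j with rfl | hij
      · simp [hw', htj]
      · simp [hw', hij]
    simp_rw [h1]
    rw [Finset.sum_add_distrib, Finset.sum_ite_eq' Finset.univ j]
    simp only [Finset.mem_univ, if_true, sub_smul, Finset.sum_sub_distrib, Finset.smul_sum,
      mul_smul, sub_add_cancel]
  have htet : IsLatticeTetrahedronAt L x v' := by
    refine ⟨fun i => ?_, fun i => ?_, ?_, w', fun i => ?_, ?_, ?_⟩
    · rcases eq_or_ne i j with rfl | hij
      · simpa [hv'] using hL
      · simpa [hv', hij] using hv.mem_lattice i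
    · rcases eq_or_ne i j with rfl | hij
      · rw [hv', Function.update_self]; exact hC
      · rw [hv', Function.update_of_ne hij]; exact hv.mem_cube i
    · rw [hv', det_vertexMatrix_update v β hβ]
      exact mul_ne_zero hj.ne' hv.det_ne_zero
    · rcases eq_or_ne i j with rfl | hij
      · simpa [hw'] using ht0
      · simpa [hw', hij] using hle i
    · have := key (fun _ => (1 : ℝ))
      simp only [smul_eq_mul, mul_one, hβ] at this
      rw [← hw1, ← this]
      refine Finset.sum_congr rfl fun i _ => ?_
      rcases eq_or_ne i j with rfl | hij <;> simp [*]
    · rw [hv', key v, hwx]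
  have h := hmin v' htet
  rw [hv', det_vertexMatrix_update v β hβ, abs_mul, abs_of_pos hj] at h
  exact (le_mul_iff_one_le_left (abs_pos.2 hv.det_ne_zero)).1 h

/-! ### Corners of the circumscribed parallelepiped -/

/-- Every coordinate of `ℝ³` excludes at most one corner of the parallelepiped circumscribed about
a tetrahedron in the cube. -/
theorem eq_of_not_mem_Icc {t : Fin 4 → ℝ} (ht : ∀ i, t i ∈ Set.Icc (0 : ℝ) 1) {k l : Fin 4}
    (hk : (∑ i, t i) / 2 - t k ∉ Set.Icc (0 : ℝ) 1)
    (hl : (∑ i, t i) / 2 - t l ∉ Set.Icc (0 : ℝ) 1) : k = l := by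
  have h0 := ht 0
  have h1 := ht 1
  have h2 := ht 2
  have h3 := ht 3
  simp only [Set.mem_Icc, not_and_or, not_le, Fin.sum_univ_four] at *
  by_contra hkl
  -- Two violations on the same side force the other two entries to sum to less than 0 or more than
  -- 2; on opposite sides, `t k` and `t l` differ by more than 1.
  fin_cases k <;> fin_cases l <;> simp at hkl hk hl <;>
    rcases hk with hk | hk <;> rcases hl with hl | hl <;> linarith

/-- Pigeonhole: four corners, three coordinates, and each coordinate excludes at most one corner. -/
theorem exists_corner_mem_cube {v : Fin 4 → Fin 3 → ℝ}
    (hv : ∀ i, v i ∈ Set.Icc (0 : Fin 3 → ℝ) 1) :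
    ∃ k, ∀ a, (∑ i, v i a) / 2 - v k a ∈ Set.Icc (0 : ℝ) 1 := by
  by_contra h
  push Not at h
  choose a ha using h
  obtain ⟨k, l, hkl, hab⟩ := Fintype.exists_ne_map_eq_of_card_lt a (by simp)
  refine hkl (eq_of_not_mem_Icc (t := fun i => v i (a k))
    (fun i => ⟨(hv i).1 _, (hv i).2 _⟩) (ha k) ?_)
  rw [hab]
  exact ha l

/-! ### Barycentric coordinates modulo the integers -/

/-- An element of a lattice of barycentric coordinates without points of coordinate sum one in the
half-open unit cube is integral or has fractional parts in `(0, 1)` with sum two. -/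
theorem fract_pos_and_sum_fract {Λ : AddSubgroup (Fin 4 → ℝ)}
    (hZ : ∀ m : Fin 4 → ℤ, (fun i => (m i : ℝ)) ∈ Λ)
    (hsum : ∀ β ∈ Λ, ∃ n : ℤ, ∑ i, β i = n)
    (hempty : ∀ β ∈ Λ, (∀ i, 0 ≤ β i) → ∑ i, β i = 1 → ∃ j, 1 ≤ β j)
    {β : Fin 4 → ℝ} (hβ : β ∈ Λ) (hne : ∃ i, Int.fract (β i) ≠ 0) :
    (∀ i, 0 < Int.fract (β i)) ∧ ∑ i, Int.fract (β i) = 2 := by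
  have hmem : ∀ γ ∈ Λ, (fun i => Int.fract (γ i)) ∈ Λ := fun γ hγ =>
    Λ.sub_mem hγ (hZ fun i => ⌊γ i⌋)
  have hne1 : ∀ γ ∈ Λ, ∑ i, Int.fract (γ i) ≠ 1 := by
    intro γ hγ h
    obtain ⟨j, hj⟩ := hempty _ (hmem γ hγ) (fun i => Int.fract_nonneg _) h
    exact absurd hj (not_le.2 (Int.fract_lt_one _))
  have hneg : ∀ t : ℝ, Int.fract (-t) = 0 ∧ Int.fract t = 0 ∨
      Int.fract (-t) = 1 - Int.fract t ∧ 0 < Int.fract t := by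
    intro t
    rcases eq_or_ne (Int.fract t) 0 with h | h
    · exact Or.inl ⟨Int.fract_neg_eq_zero.2 h, h⟩
    · exact Or.inr ⟨Int.fract_neg h, lt_of_le_of_ne (Int.fract_nonneg _) h.symm⟩
  -- The fractional parts of `β` and `-β` each sum to an integer at least 2, while together they sum
  -- to at most 4; equality holds throughout.
  obtain ⟨n, hn⟩ := hsum _ (hmem β hβ)
  obtain ⟨n', hn'⟩ := hsum _ (hmem _ (Λ.neg_mem hβ))
  have e1 := hne1 β hβ
  have e2 := hne1 _ (Λ.neg_mem hβ)
  simp only [hn, hn'] at e1 e2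
  have e1 : n ≠ 1 := by exact_mod_cast e1
  have e2 : n' ≠ 1 := by exact_mod_cast e2
  have hb : ∀ i, Int.fract (β i) < 1 := fun i => Int.fract_lt_one _
  have hpos : 0 < ∑ i, Int.fract (β i) := by
    obtain ⟨i, hi⟩ := hne
    exact Finset.sum_pos' (fun i _ => Int.fract_nonneg _)
      ⟨i, Finset.mem_univ _, lt_of_le_of_ne (Int.fract_nonneg _) hi.symm⟩
  have hpos' : 0 < ∑ i, Int.fract ((-β) i) := by
    obtain ⟨i, hi⟩ := hne
    exact Finset.sum_pos' (fun i _ => Int.fract_nonneg _)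
      ⟨i, Finset.mem_univ _, lt_of_le_of_ne (Int.fract_nonneg _)
        (fun h => hi (Int.fract_neg_eq_zero.1 h.symm))⟩
  rw [hn] at hpos
  rw [hn'] at hpos'
  have hn2 : 2 ≤ n := by
    have : 0 < n := by exact_mod_cast hpos
    omega
  have hn2' : 2 ≤ n' := by
    have : 0 < n' := by exact_mod_cast hpos'
    omega
  have hr : (2 : ℝ) ≤ n := by exact_mod_cast hn2
  have hr' : (2 : ℝ) ≤ n' := by exact_mod_cast hn2'
  have hle : ∀ i, Int.fract (-(β i)) + Int.fract (β i) ≤ 1 := by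
    intro i
    rcases hneg (β i) with h | h <;> linarith [h.1, h.2]
  rw [Fin.sum_univ_four] at hn hn'
  simp only [Pi.neg_apply] at hn'
  have l0 := hle 0
  have l1 := hle 1
  have l2 := hle 2
  have l3 := hle 3
  refine ⟨fun i => ?_, by rw [Fin.sum_univ_four]; linarith⟩
  rcases hneg (β i) with h | h
  · obtain rfl | rfl | rfl | rfl : i = 0 ∨ i = 1 ∨ i = 2 ∨ i = 3 := by omega
    all_goals linarith [h.1, h.2]
  · exact h.2

/-- The lattice contains, for every coordinate `k`, a vector whose `k`-th coordinate attains the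
minimal distance `ε` of a coordinate to the integers. -/
theorem exists_minimal_coordinate {Λ : AddSubgroup (Fin 4 → ℝ)}
    (hZ : ∀ m : Fin 4 → ℤ, (fun i => (m i : ℝ)) ∈ Λ)
    (hfr : ∀ β ∈ Λ, (∃ i, Int.fract (β i) ≠ 0) →
      (∀ i, 0 < Int.fract (β i)) ∧ ∑ i, Int.fract (β i) = 2)
    (hN : ∃ N : ℕ, 0 < N ∧ ∀ β ∈ Λ, ∀ i, Int.fract (N * β i) = 0)
    (hne : ∃ β ∈ Λ, ∃ i, Int.fract (β i) ≠ 0) (k : Fin 4) :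
    ∃ c ∈ Λ, ∃ ε : ℝ, 0 < ε ∧ c k = ε ∧ (∀ i, ε ≤ c i ∧ c i ≤ 1 - ε) ∧ ∑ i, c i = 2 := by
  classical
  obtain ⟨N, ⟨hN0, hNΛ⟩, hmin⟩ : ∃ N : ℕ, (0 < N ∧ ∀ β ∈ Λ, ∀ i, Int.fract (N * β i) = 0) ∧
      ∀ n : ℕ, (0 < n ∧ ∀ β ∈ Λ, ∀ i, Int.fract (n * β i) = 0) → N ≤ n :=
    ⟨Nat.find hN, Nat.find_spec hN, fun n hn => Nat.find_min' hN hn⟩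
  have hNR : (0 : ℝ) < N := by exact_mod_cast hN0
  -- The integers `N * β k`, for `β ∈ Λ`, form a subgroup of `ℤ`.
  let H : AddSubgroup ℤ :=
    { carrier := {m | ∃ β ∈ Λ, (N : ℝ) * β k = m}
      zero_mem' := ⟨0, Λ.zero_mem, by simp⟩
      add_mem' := by
        rintro a b ⟨β, hβ, h⟩ ⟨γ, hγ, h'⟩
        exact ⟨β + γ, Λ.add_mem hβ hγ, by push_cast; rw [← h, ← h', Pi.add_apply]; ring⟩
      neg_mem' := by
        rintro a ⟨β, hβ, h⟩
        exact ⟨-β, Λ.neg_mem hβ, by push_cast; rw [← h, Pi.neg_apply]; ring⟩ }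
  obtain ⟨a, ha⟩ := Int.subgroup_cyclic H
  have hNH : (N : ℤ) ∈ H := ⟨fun _ => ((1 : ℤ) : ℝ), hZ fun _ => 1, by simp⟩
  have hdvd : ∀ m ∈ H, a ∣ m := by
    intro m hm
    rw [ha, AddSubgroup.mem_closure_singleton] at hm
    obtain ⟨n, rfl⟩ := hm
    exact ⟨n, by simp [mul_comm]⟩
  obtain ⟨n, hn⟩ := Int.natCast_dvd_natCast.1 (Int.natAbs_dvd.2 (hdvd _ hNH) |>.trans dvd_rfl)
  have hn0 : 0 < n := Nat.pos_of_ne_zero (by rintro rfl; omega)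
  have ha0 : 0 < a.natAbs := Nat.pos_of_ne_zero (by intro h; rw [h] at hn; omega)
  -- With `n = N / |a|`, the `k`-th coordinate of `n • β` is an integer, so by `hfr` all of them
  -- are. Minimality of `N` then gives `|a| = 1`.
  have hnΛ : ∀ β ∈ Λ, ∀ i, Int.fract (n * β i) = 0 := by
    intro β hβ
    obtain ⟨m, hm⟩ := Int.fract_eq_zero_iff.1 (hNΛ β hβ k)
    obtain ⟨q, hq⟩ := Int.natAbs_dvd.2 (hdvd m ⟨β, hβ, hm.symm⟩)
    have hk : Int.fract ((n • β) k) = 0 := by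
      rw [Int.fract_eq_zero_iff]
      refine ⟨q, ?_⟩
      have haR : (0 : ℝ) < a.natAbs := by exact_mod_cast ha0
      apply mul_left_cancel₀ haR.ne'
      have h1 : ((a.natAbs : ℕ) : ℝ) * (q : ℝ) = m := by
        rw [hq]; push_cast; simp
      rw [h1, hm, hn]
      simp [mul_assoc]
    intro i
    by_contra hi
    have := (hfr (n • β) (Λ.nsmul_mem hβ n) ⟨i, by simpa using hi⟩).1 k
    exact this.ne' hk
  have hNn := hmin n ⟨hn0, hnΛ⟩
  have ha1 : a.natAbs = 1 := by
    rw [hn] at hNn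
    exact Nat.le_antisymm (by by_contra h; push Not at h; nlinarith) ha0
  have h1H : (1 : ℤ) ∈ H := by
    rcases Int.natAbs_eq a with h | h
    · rw [ha1] at h
      rw [ha, h]
      exact AddSubgroup.subset_closure rfl
    · rw [ha1] at h
      rw [ha, h]
      simp
  obtain ⟨c, hc, hck⟩ := h1H
  have hN2 : 2 ≤ N := by
    by_contra h
    have h1 : N = 1 := by omega
    obtain ⟨β, hβ, i, hi⟩ := hne
    exact hi (by simpa [h1] using hNΛ β hβ i)
  have hN2R : (2 : ℝ) ≤ N := by exact_mod_cast hN2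
  have hck : c k = 1 / N := by
    field_simp
    push_cast at hck
    linarith
  have hfk : Int.fract (c k) = 1 / N := by
    rw [hck, Int.fract_eq_self]
    exact ⟨by positivity, by rw [div_lt_one hNR]; linarith⟩
  have hεpos : (0 : ℝ) < 1 / N := by positivity
  obtain ⟨hpos, hsum⟩ := hfr c hc ⟨k, by rw [hfk]; exact hεpos.ne'⟩
  have hmem : (fun i => Int.fract (c i)) ∈ Λ := Λ.sub_mem hc (hZ fun i => ⌊c i⌋)
  refine ⟨_, hmem, 1 / N, hεpos, hfk, fun i => ?_, hsum⟩
  obtain ⟨m, hm⟩ := Int.fract_eq_zero_iff.1 (hNΛ _ hmem i)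
  have h0 : (0 : ℝ) < m := by rw [hm]; exact mul_pos hNR (hpos i)
  have h1 : (m : ℝ) < N := by
    rw [hm]; nlinarith [Int.fract_lt_one (c i)]
  have h0 : (1 : ℝ) ≤ m := by
    have : 0 < m := by exact_mod_cast h0
    exact_mod_cast this
  have h1 : (m : ℝ) + 1 ≤ N := by
    have : m < N := by exact_mod_cast h1
    exact_mod_cast this
  have e : Int.fract (c i) = m / N := by
    rw [hm]; field_simp
  constructor
  · rw [e]; gcongr
  · rw [e, le_sub_iff_add_le, ← add_div, div_le_one hNR]; exact h1

/-! ### Minimal tetrahedra are unimodular -/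

/-- The barycentric coordinates, with respect to `v` and of arbitrary integral sum, of the vectors
of `L`. -/
def coordinateLattice (L : AddSubgroup (Fin 3 → ℝ)) (v : Fin 4 → Fin 3 → ℝ) :
    AddSubgroup (Fin 4 → ℝ) where
  carrier := {β | (∃ n : ℤ, ∑ i, β i = n) ∧ ∑ i, β i • v i ∈ L}
  zero_mem' := ⟨⟨0, by simp⟩, by simp⟩
  add_mem' := by
    rintro β γ ⟨⟨m, hm⟩, h⟩ ⟨⟨n, hn⟩, h'⟩
    refine ⟨⟨m + n, by simp [Finset.sum_add_distrib, hm, hn]⟩, ?_⟩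
    simpa [Finset.sum_add_distrib, add_smul] using L.add_mem h h'
  neg_mem' := by
    rintro β ⟨⟨m, hm⟩, h⟩
    refine ⟨⟨-m, by simp [hm]⟩, ?_⟩
    simpa using L.neg_mem h

theorem intCast_mem_coordinateLattice {L : AddSubgroup (Fin 3 → ℝ)} {v : Fin 4 → Fin 3 → ℝ}
    (hv : ∀ i, v i ∈ L) (m : Fin 4 → ℤ) : (fun i => (m i : ℝ)) ∈ coordinateLattice L v :=
  ⟨⟨∑ i, m i, by simp⟩, L.sum_mem fun i _ => by
    simpa [Int.cast_smul_eq_zsmul] using L.zsmul_mem (hv i) (m i)⟩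

/-- The integral vectors have finite exponent in the coordinate lattice of a discrete lattice. -/
theorem exists_exponent_coordinateLattice {L : AddSubgroup (Fin 3 → ℝ)}
    (hfin : {y ∈ L | y ∈ Set.Icc (0 : Fin 3 → ℝ) 4}.Finite) {v : Fin 4 → Fin 3 → ℝ}
    (hv : ∀ i, v i ∈ L) (hC : ∀ i, v i ∈ Set.Icc (0 : Fin 3 → ℝ) 1)
    (hdet : (vertexMatrix v).det ≠ 0) :
    ∃ N : ℕ, 0 < N ∧ ∀ β ∈ coordinateLattice L v, ∀ i, Int.fract (N * β i) = 0 := by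
  classical
  set B : Set (Fin 4 → ℝ) := {β ∈ coordinateLattice L v | ∀ i, 0 ≤ β i ∧ β i < 1} with hB
  have hBfin : B.Finite := by
    -- Four vertices in the cube with coefficients below 1 combine to a point of `[0,4]³`, whence
    -- the bound 4 in `hfin`.
    refine Set.Finite.of_finite_image (f := fun β => (∑ i, β i, ∑ i, β i • v i))
      ((((Set.finite_Icc (0 : ℤ) 4).image (fun n : ℤ => (n : ℝ))).prod hfin).subset ?_) ?_
    · rintro _ ⟨β, ⟨⟨⟨n, hn⟩, hβ⟩, hb⟩, rfl⟩
      refine ⟨⟨n, ⟨?_, ?_⟩, hn.symm⟩, hβ, fun a => ?_, fun a => ?_⟩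
      · have : 0 ≤ ∑ i, β i := Finset.sum_nonneg fun i _ => (hb i).1
        rw [hn] at this
        exact_mod_cast this
      · have : ∑ i, β i ≤ ∑ _i : Fin 4, (1 : ℝ) := Finset.sum_le_sum fun i _ => (hb i).2.le
        rw [hn, Fin.sum_const, nsmul_one] at this
        exact_mod_cast this
      · simp only [Finset.sum_apply, Pi.smul_apply, smul_eq_mul]
        exact Finset.sum_nonneg fun i _ => mul_nonneg (hb i).1 ((hC i).1 a)
      · simp only [Finset.sum_apply, Pi.smul_apply, smul_eq_mul]
        calc ∑ i, β i * v i a ≤ ∑ _i : Fin 4, (1 : ℝ) := Finset.sum_le_sum fun i _ =>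
              mul_le_one₀ (hb i).2.le ((hC i).1 a) ((hC i).2 a)
          _ = (4 : Fin 3 → ℝ) a := by simp
    · intro β _ γ _ h
      simp only [Prod.mk.injEq] at h
      refine sub_eq_zero.1 (eq_zero_of_sum_smul_eq_zero hdet ?_ ?_)
      · simp [h.1]
      · simp [sub_smul, h.2]
  refine ⟨hBfin.toFinset.card.factorial, Nat.factorial_pos _, fun β hβ => ?_⟩
  have hmaps : ∀ m ∈ Finset.range (hBfin.toFinset.card + 1),
      (fun i => Int.fract ((m : ℝ) * β i)) ∈ hBfin.toFinset := by
    intro m _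
    rw [Set.Finite.mem_toFinset]
    refine ⟨?_, fun i => ⟨Int.fract_nonneg _, Int.fract_lt_one _⟩⟩
    have := (coordinateLattice L v).sub_mem ((coordinateLattice L v).nsmul_mem hβ m)
      (intCast_mem_coordinateLattice hv fun i => ⌊(m : ℝ) * β i⌋)
    convert this using 1
    ext i
    simp
  -- Two multiples of `β` agree modulo `ℤ⁴`, and their difference `m' - m` divides the factorial.
  obtain ⟨m, hm, m', hm', hne, heq⟩ :=
    Finset.exists_ne_map_eq_of_card_lt_of_maps_to (by simp) hmaps
  wlog hlt : m < m' generalizing m m'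
  · exact this m' hm' m hm hne.symm heq.symm (by omega)
  intro i
  have hi := congrFun heq i
  obtain ⟨z, hz⟩ := Int.fract_eq_fract.1 hi.symm
  obtain ⟨q, hq⟩ : m' - m ∣ hBfin.toFinset.card.factorial :=
    Nat.dvd_factorial (by omega) (by simp at hm'; omega)
  rw [Int.fract_eq_zero_iff]
  refine ⟨q * z, ?_⟩
  rw [hq]
  push_cast [Nat.cast_sub hlt.le]
  rw [← hz]
  ring

/-- A tetrahedron of minimal volume among the lattice tetrahedra of the cube containing `x` has
vertices that generate the lattice. -/
theorem IsLatticeTetrahedronAt.exists_int_coordinates {L : AddSubgroup (Fin 3 → ℝ)}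
    (hfin : {y ∈ L | y ∈ Set.Icc (0 : Fin 3 → ℝ) 4}.Finite) {x : Fin 3 → ℝ}
    {v : Fin 4 → Fin 3 → ℝ} (hv : IsLatticeTetrahedronAt L x v)
    (hmin : ∀ v', IsLatticeTetrahedronAt L x v' →
      |(vertexMatrix v).det| ≤ |(vertexMatrix v').det|)
    {β : Fin 4 → ℝ} (hβ : β ∈ coordinateLattice L v) : ∃ m : Fin 4 → ℤ, ∀ i, β i = m i := by
  by_contra hnon
  have hne : ∃ β ∈ coordinateLattice L v, ∃ i, Int.fract (β i) ≠ 0 := by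
    refine ⟨β, hβ, ?_⟩
    by_contra! h
    exact hnon ⟨fun i => ⌊β i⌋, fun i => by
      linarith [Int.self_sub_floor (β i), h i]⟩
  have hZ := intCast_mem_coordinateLattice hv.mem_lattice
  have hempty : ∀ β ∈ coordinateLattice L v, (∀ i, 0 ≤ β i) → ∑ i, β i = 1 → ∃ j, 1 ≤ β j := by
    intro β hβ h0 h1
    refine hv.exists_one_le hmin h1 hβ.2 ?_
    exact (convex_Icc (0 : Fin 3 → ℝ) 1).sum_mem (fun i _ => h0 i) h1 fun i _ => hv.mem_cube i
  have hfr := fun β hβ hβ' => fract_pos_and_sum_fract hZ (fun β hβ => hβ.1) hempty (β := β) hβ hβ'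
  obtain ⟨k, hk⟩ := exists_corner_mem_cube hv.mem_cube
  obtain ⟨c, hc, ε, hε, hck, hcε, hcsum⟩ := exists_minimal_coordinate hZ hfr
    (exists_exponent_coordinateLattice hfin hv.mem_lattice hv.mem_cube hv.det_ne_zero) hne k
  -- Reflecting `c` makes the `k`-th coordinate `-ε` and leaves the others in `[ε, 1 - ε]`, with sum
  -- `3 - 2 = 1`.
  set γ : Fin 4 → ℝ := fun i => ((1 - Pi.single k 1 : Fin 4 → ℤ) i : ℝ) - c i with hγ
  have hγΛ : γ ∈ coordinateLattice L v := (coordinateLattice L v).sub_mem (hZ _) hc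
  have hγk : γ k = -ε := by simp [hγ, hck]
  have hγi : ∀ i, i ≠ k → γ i = 1 - c i := fun i hi => by simp [hγ, hi]
  have hsingle : ∑ i, ((Pi.single k 1 : Fin 4 → ℤ) i : ℝ) = 1 := by
    rw [Finset.sum_eq_single k] <;> simp +contextual
  have hγsum : ∑ i, γ i = 1 := by
    simp only [hγ, Pi.sub_apply, Pi.one_apply, Int.cast_sub, Int.cast_one, Finset.sum_sub_distrib,
      hsingle, hcsum]
    norm_num
  -- A convex combination of the vertices other than `v k` and the corner opposite `v k`, with
  -- weight `2ε` on the corner.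
  have hγv : ∀ a, (∑ i, γ i • v i) a =
      ∑ i ∈ Finset.univ.erase k, (γ i - ε) * v i a +
        2 * ε * ((∑ i, v i a) / 2 - v k a) := by
    intro a
    simp only [Finset.sum_apply, Pi.smul_apply, smul_eq_mul]
    rw [← Finset.add_sum_erase _ _ (Finset.mem_univ k),
      ← Finset.add_sum_erase _ (fun i => v i a) (Finset.mem_univ k), hγk]
    simp only [sub_mul, Finset.sum_sub_distrib, ← Finset.mul_sum]
    ring
  have hcoef : ∑ i ∈ Finset.univ.erase k, (γ i - ε) = 1 - 2 * ε := by
    rw [Finset.sum_sub_distrib, Finset.sum_const, Finset.card_erase_of_mem (Finset.mem_univ k)]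
    norm_num
    linarith
  have hcoef0 : ∀ i ∈ Finset.univ.erase k, 0 ≤ γ i - ε := by
    intro i hi
    rw [hγi i (Finset.ne_of_mem_erase hi)]
    linarith [(hcε i).2]
  have hcube : ∑ i, γ i • v i ∈ Set.Icc (0 : Fin 3 → ℝ) 1 := by
    refine ⟨fun a => ?_, fun a => ?_⟩
    · rw [hγv]
      exact add_nonneg (Finset.sum_nonneg fun i hi =>
        mul_nonneg (hcoef0 i hi) ((hv.mem_cube i).1 a)) (mul_nonneg (by positivity) (hk a).1)
    · rw [hγv]
      calc _ ≤ ∑ i ∈ Finset.univ.erase k, (γ i - ε) + 2 * ε :=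
            add_le_add (Finset.sum_le_sum fun i hi =>
              mul_le_of_le_one_right (hcoef0 i hi) ((hv.mem_cube i).2 a))
              (mul_le_of_le_one_right (by positivity) (hk a).2)
        _ = (1 : Fin 3 → ℝ) a := by rw [hcoef]; simp
  obtain ⟨j, hj⟩ := hv.exists_one_le hmin hγsum hγΛ.2 hcube
  rcases eq_or_ne j k with rfl | hjk
  · linarith
  · rw [hγi j hjk] at hj
    linarith [(hcε j).1]

/-! ### Existence of tetrahedra around a point -/

/-- Every point of the cube lies in a tetrahedron whose vertices are vertices of the cube. -/
theorem exists_isLatticeTetrahedronAt {L : AddSubgroup (Fin 3 → ℝ)}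
    (hL : ∀ a, (Pi.single a 1 : Fin 3 → ℝ) ∈ L) {x : Fin 3 → ℝ}
    (hx : x ∈ Set.Icc (0 : Fin 3 → ℝ) 1) : ∃ v, IsLatticeTetrahedronAt L x v := by
  obtain ⟨σ, hσ⟩ : ∃ σ : Equiv.Perm (Fin 3), Antitone (x ∘ σ) :=
    ⟨Tuple.sort (fun a => -x a), fun a b hab => by
      simpa using Tuple.monotone_sort (fun a => -x a) hab⟩
  have h01 := hσ (show (0 : Fin 3) ≤ 1 by decide)
  have h12 := hσ (show (1 : Fin 3) ≤ 2 by decide)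
  simp only [Function.comp_apply] at h01 h12
  -- Freudenthal simplex: `v i` is the indicator of the `i` largest coordinates of `x`; the weights
  -- are the successive gaps.
  set v : Fin 4 → Fin 3 → ℝ := fun i a => if (σ.symm a : ℕ) < i then 1 else 0 with hv
  have hcomb : ∀ (w : Fin 4 → ℝ) (b : Fin 3), (∑ i, w i • v i) (σ b) =
      ∑ i, w i * if (b : ℕ) < i then 1 else 0 := by
    intro w b
    simp [hv]
  refine ⟨v, ⟨fun i => ?_, fun i => ⟨fun a => ?_, fun a => ?_⟩, ?_,
    ![1 - x (σ 0), x (σ 0) - x (σ 1), x (σ 1) - x (σ 2), x (σ 2)], ?_, ?_, ?_⟩⟩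
  · have : v i = ∑ a, if (σ.symm a : ℕ) < i then Pi.single a 1 else 0 := by
      ext b
      rw [Finset.sum_apply, Finset.sum_eq_single b]
      · simp only [hv]; split_ifs <;> simp
      · intro c _ hc; split_ifs <;> simp [hc.symm]
      · simp
    rw [this]
    exact L.sum_mem fun a _ => by split_ifs; exacts [hL a, L.zero_mem]
  · simp only [hv]; split_ifs <;> simp
  · simp only [hv]; split_ifs <;> simp
  · refine det_vertexMatrix_ne_zero fun β h0 h1 => ?_
    have e := fun b => (hcomb β b).symm.trans (congrFun h1 (σ b))
    have e0 := e 0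
    have e1 := e 1
    have e2 := e 2
    simp [Fin.sum_univ_four] at e0 e1 e2 h0
    ext i
    fin_cases i <;> simp <;> linarith
  · intro i
    have := hx.1 (σ 2)
    have := hx.2 (σ 0)
    fin_cases i <;> simp at * <;> linarith
  · simp [Fin.sum_univ_four]
  · ext a
    obtain ⟨b, rfl⟩ := σ.surjective a
    rw [hcomb]
    fin_cases b <;> simp [Fin.sum_univ_four]

/-- Every point of the cube lies in a tetrahedron in the cube that is unimodular for `L`. -/
theorem exists_unimodular_tetrahedron {L : AddSubgroup (Fin 3 → ℝ)}
    (hL : ∀ a, (Pi.single a 1 : Fin 3 → ℝ) ∈ L)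
    (hfin : {y ∈ L | y ∈ Set.Icc (0 : Fin 3 → ℝ) 4}.Finite) {x : Fin 3 → ℝ}
    (hx : x ∈ Set.Icc (0 : Fin 3 → ℝ) 1) :
    ∃ v, IsLatticeTetrahedronAt L x v ∧
      ∀ β ∈ coordinateLattice L v, ∃ m : Fin 4 → ℤ, ∀ i, β i = m i := by
  have hT : {v | IsLatticeTetrahedronAt L x v}.Finite :=
    (Set.Finite.pi' fun _ : Fin 4 => hfin).subset fun v hv i =>
      ⟨hv.mem_lattice i, (hv.mem_cube i).1, (hv.mem_cube i).2.trans fun a => by norm_num⟩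
  obtain ⟨v, hv, hmin⟩ := Set.exists_min_image _ (fun v => |(vertexMatrix v).det|) hT
    (exists_isLatticeTetrahedronAt hL hx)
  exact ⟨v, hv, fun β hβ => hv.exists_int_coordinates hfin hmin hβ⟩

/-! ### Transfer to the parallelepiped -/

theorem finite_latticePoints_inter_of_isBounded {d : ℕ} {S : Set (Fin d → ℝ)}
    (hS : Bornology.IsBounded S) : (latticePoints d ∩ S).Finite := by
  obtain ⟨R, hR⟩ := hS.exists_norm_le
  refine ((Set.Finite.pi' fun _ : Fin d => Set.finite_Icc (-⌈R⌉) ⌈R⌉).image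
    (fun (m : Fin d → ℤ) i => (m i : ℝ))).subset ?_
  rintro x ⟨hx, hxS⟩
  choose m hm using hx
  refine ⟨m, fun i => ?_, funext fun i => (hm i).symm⟩
  have h := ((norm_le_pi_norm x i).trans (hR x hxS)).trans (Int.le_ceil R)
  rw [hm, Real.norm_eq_abs, abs_le] at h
  exact ⟨by exact_mod_cast h.1, by exact_mod_cast h.2⟩

theorem image_mem_extremePoints {d : ℕ} {f : (Fin 3 → ℝ) →ᵃ[ℝ] (Fin d → ℝ)}
    (hf : Function.Injective f) {e : Fin 3 → ℝ} (he : ∀ i, e i = 0 ∨ e i = 1) :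
    f e ∈ Set.extremePoints ℝ (f '' Set.Icc 0 1) := by
  have heC : e ∈ Set.Icc (0 : Fin 3 → ℝ) 1 := by
    refine ⟨fun i => ?_, fun i => ?_⟩ <;> rcases he i with h | h <;> simp [h]
  refine mem_extremePoints.2 ⟨⟨e, heC, rfl⟩, ?_⟩
  rintro _ ⟨a, ha, rfl⟩ _ ⟨b, hb, rfl⟩ h
  rw [← image_openSegment] at h
  obtain ⟨c, hc, hce⟩ := h
  obtain rfl := hf hce
  obtain ⟨s, t, hs, ht, hst, rfl⟩ := hc
  have key : ∀ i, a i = (s • a + t • b) i ∧ b i = (s • a + t • b) i := by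
    intro i
    have ha0 : 0 ≤ a i := ha.1 i
    have ha1 : a i ≤ 1 := ha.2 i
    have hb0 : 0 ≤ b i := hb.1 i
    have hb1 : b i ≤ 1 := hb.2 i
    have hi := he i
    simp only [Pi.add_apply, Pi.smul_apply, smul_eq_mul] at hi ⊢
    obtain rfl : t = 1 - s := by linarith
    rcases hi with h | h
    · have h1 : s * a i = 0 := by nlinarith [mul_nonneg hs.le ha0, mul_nonneg ht.le hb0]
      have h2 : (1 - s) * b i = 0 := by linarith
      rw [h]
      exact ⟨(mul_eq_zero.1 h1).resolve_left hs.ne', (mul_eq_zero.1 h2).resolve_left ht.ne'⟩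
    · have h1 : s * (1 - a i) = 0 := by
        nlinarith [mul_nonneg hs.le (sub_nonneg.2 ha1), mul_nonneg ht.le (sub_nonneg.2 hb1)]
      have h2 : (1 - s) * (1 - b i) = 0 := by linarith
      rw [h]
      exact ⟨(sub_eq_zero.1 ((mul_eq_zero.1 h1).resolve_left hs.ne')).symm,
        (sub_eq_zero.1 ((mul_eq_zero.1 h2).resolve_left ht.ne')).symm⟩
  exact ⟨congrArg f (funext fun i => (key i).1), congrArg f (funext fun i => (key i).2)⟩

/-- The vectors that a linear map sends to integral vectors. -/
def integralPreimage {d : ℕ} (A : (Fin 3 → ℝ) →ₗ[ℝ] (Fin d → ℝ)) : AddSubgroup (Fin 3 → ℝ) where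
  carrier := {y | A y ∈ latticePoints d}
  zero_mem' := fun i => ⟨0, by simp⟩
  add_mem' := by
    intro a b ha hb i
    obtain ⟨m, hm⟩ := ha i
    obtain ⟨n, hn⟩ := hb i
    exact ⟨m + n, by simp [hm, hn]⟩
  neg_mem' := by
    intro a ha i
    obtain ⟨m, hm⟩ := ha i
    exact ⟨-m, by simp [hm]⟩

theorem AffineMap.map_sum_smul {ι V W : Type*} [Fintype ι] [AddCommGroup V] [Module ℝ V]
    [AddCommGroup W] [Module ℝ W] (f : V →ᵃ[ℝ] W) (w : ι → ℝ) (v : ι → V) (hw : ∑ i, w i = 1) :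
    f (∑ i, w i • v i) = ∑ i, w i • f (v i) := by
  have h : ∀ x, f x = f.linear x + f 0 := fun x => congrFun f.decomp x
  have h' : ∀ i, w i • f (v i) = f.linear (w i • v i) + w i • f 0 := fun i => by
    rw [h (v i), smul_add, map_smul]
  rw [h, Finset.sum_congr rfl fun i _ => h' i, Finset.sum_add_distrib, ← Finset.sum_smul, hw,
    one_smul, map_sum]

theorem isUnimodularSimplex_image {d : ℕ} {f : (Fin 3 → ℝ) →ᵃ[ℝ] (Fin d → ℝ)}
    (hf : Function.Injective f) (hf0 : f 0 ∈ latticePoints d) {x : Fin 3 → ℝ}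
    {v : Fin 4 → Fin 3 → ℝ} (hv : IsLatticeTetrahedronAt (integralPreimage f.linear) x v)
    (hint : ∀ β ∈ coordinateLattice (integralPreimage f.linear) v,
      ∃ m : Fin 4 → ℤ, ∀ i, β i = m i) :
    IsUnimodularSimplex 3 (convexHull ℝ (Set.range (f ∘ v))) := by
  have hdec : ∀ y, f y = f.linear y + f 0 := fun y => congrFun f.decomp y
  have hmem : ∀ y, f y ∈ latticePoints d ↔ y ∈ integralPreimage f.linear := by
    intro y
    constructor
    · intro h i
      obtain ⟨m, hm⟩ := h i
      obtain ⟨n, hn⟩ := hf0 i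
      exact ⟨m - n, by rw [hdec, Pi.add_apply] at hm; push_cast; linarith⟩
    · intro h i
      obtain ⟨m, hm⟩ := h i
      obtain ⟨n, hn⟩ := hf0 i
      exact ⟨m + n, by rw [hdec, Pi.add_apply]; push_cast; linarith⟩
  refine ⟨f ∘ v, AffineIndependent.map' ?_ f hf, fun i => (hmem _).2 (hv.mem_lattice i), ?_, rfl⟩
  · rw [affineIndependent_iff_of_fintype]
    intro w hw h i
    rw [Finset.weightedVSub_eq_linear_combination _ hw] at h
    rw [eq_zero_of_sum_smul_eq_zero hv.det_ne_zero hw h]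
    rfl
  · intro y hy hspan
    obtain ⟨w, hw, rfl⟩ := eq_affineCombination_of_mem_affineSpan_of_fintype hspan
    rw [Finset.affineCombination_eq_linear_combination _ _ _ hw] at hy ⊢
    have hfw := f.map_sum_smul w v hw
    simp only [Function.comp_apply] at hy ⊢
    rw [← hfw, hmem] at hy
    obtain ⟨m, hm⟩ := hint w ⟨⟨1, by simpa using hw⟩, hy⟩
    refine ⟨m, ?_, by simp [hm]⟩
    simp only [hm] at hw
    exact_mod_cast hw

theorem mainTheorem1 (d : ℕ) (P : Set (Fin d → ℝ)) (hP : IsLatticeParallelepiped 3 P) :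
    HasUnimodularCover 3 P := by
  obtain ⟨⟨f, hf, rfl⟩, hext⟩ := hP
  have hf0 : f 0 ∈ latticePoints d := hext (image_mem_extremePoints hf fun i => Or.inl rfl)
  have hL : ∀ a, (Pi.single a 1 : Fin 3 → ℝ) ∈ integralPreimage f.linear := by
    intro a i
    have h : f (Pi.single a 1) ∈ latticePoints d := hext (image_mem_extremePoints hf fun b => by
      rcases eq_or_ne b a with rfl | hb <;> simp [*])
    obtain ⟨m, hm⟩ := h i
    obtain ⟨n, hn⟩ := hf0 i
    refine ⟨m - n, ?_⟩
    rw [f.decomp, Pi.add_apply, Pi.add_apply] at hm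
    push_cast
    linarith
  have hlin : Function.Injective f.linear := f.linear_injective_iff.2 hf
  have hfin : {y ∈ integralPreimage f.linear | y ∈ Set.Icc (0 : Fin 3 → ℝ) 4}.Finite := by
    refine Set.Finite.of_finite_image (f := f.linear)
      ((finite_latticePoints_inter_of_isBounded (S := f.linear '' Set.Icc 0 4)
        (isCompact_Icc.image f.linear.continuous_of_finiteDimensional).isBounded).subset ?_)
      hlin.injOn
    rintro _ ⟨y, ⟨hy, hyC⟩, rfl⟩
    exact ⟨hy, y, hyC, rfl⟩
  let T : Set (Fin 4 → Fin 3 → ℝ) := {v | ∃ x,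
    IsLatticeTetrahedronAt (integralPreimage f.linear) x v ∧
      ∀ β ∈ coordinateLattice (integralPreimage f.linear) v, ∃ m : Fin 4 → ℤ, ∀ i, β i = m i}
  -- Although `x` ranges over infinitely many points, the vertices come from a finite set.
  have hT : T.Finite := (Set.Finite.pi' fun _ : Fin 4 => hfin).subset fun v ⟨x, hv, _⟩ i =>
    ⟨hv.mem_lattice i, (hv.mem_cube i).1, (hv.mem_cube i).2.trans fun a => by norm_num⟩
  refine ⟨(fun v => convexHull ℝ (Set.range (f ∘ v))) '' T, hT.image _, ?_, ?_⟩
  · rintro _ ⟨v, ⟨x, hv, hint⟩, rfl⟩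
    exact isUnimodularSimplex_image hf hf0 hv hint
  · refine Set.Subset.antisymm (Set.sUnion_subset ?_) ?_
    · rintro _ ⟨v, ⟨x, hv, hint⟩, rfl⟩
      refine convexHull_min ?_ ((convex_Icc (0 : Fin 3 → ℝ) 1).affine_image f)
      rintro _ ⟨i, rfl⟩
      exact ⟨v i, hv.mem_cube i, rfl⟩
    · rintro _ ⟨x, hx, rfl⟩
      obtain ⟨v, hv, hint⟩ := exists_unimodular_tetrahedron hL hfin hx
      refine ⟨_, ⟨v, ⟨x, hv, hint⟩, rfl⟩, ?_⟩
      obtain ⟨w, hw0, hw1, rfl⟩ := hv.exists_weights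
      rw [f.map_sum_smul w v hw1]
      exact (convex_convexHull ℝ _).sum_mem (fun i _ => hw0 i) hw1 fun i _ =>
        subset_convexHull ℝ _ ⟨i, rfl⟩
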